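/- There is an absolute constant $C>0$ such that the following holds. Let $T$ be a finite tree with $n\ge 1$ vertices, and let $\vartheta$ be the number of its vertices of odd degree. Then $T$ has a crossing-free straight-line drawing in the plane such that - the vertices are placed on distinct points of an integer grid $\{0,\dots,W\}\times\{0,\dots,H\}$ of quasi-polynomial size, namely $W,H\le n^{C\log_2 n}$, and - the drawing uses exactly $\vartheta/2$ line segments, and this number is the smallest possible: no crossing-free straight-line drawing of $T$ (with arbitrary real vertex coordinates) uses fewer segments. Here, in a crossing-free straight-line drawing, distinct vertices are distinct points, each edge is the line segment between its ends, no edge passes through a vertex other than its two ends, and two distinct edges meet at most in a common end. A drawing uses (that is, can be represented with) $k$ segments if the union of its edges is the union of $k$ nondegenerate closed line segments; so one segment may represent several consecutive collinear edges. -/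

import Mathlib

/-- A (crossing-free) straight-line drawing of a graph in the plane: vertices are distinct points,
an edge `uv` is the segment from `pos u` to `pos v`, no edge passes through a vertex other than
its two ends, and two distinct edges meet at most in a common end. -/
structure StraightLineDrawing {V : Type*} (G : SimpleGraph V) where
  /-- the position of each vertex -/
  pos : V → ℝ × ℝ
  pos_injective : Function.Injective pos
  vertex_not_on_edge : ∀ u v w : V, G.Adj u v →
    pos w ∈ segment ℝ (pos u) (pos v) → w = u ∨ w = v
  edges_disjoint : ∀ u v u' v' : V, G.Adj u v → G.Adj u' v' → s(u, v) ≠ s(u', v') →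
    Disjoint (openSegment ℝ (pos u) (pos v)) (openSegment ℝ (pos u') (pos v'))

namespace StraightLineDrawing

variable {V : Type*} {G : SimpleGraph V}

/-- The set of points of the plane covered by the drawn edges. -/
def edgePoints (D : StraightLineDrawing G) : Set (ℝ × ℝ) :=
  {x | ∃ u v : V, G.Adj u v ∧ x ∈ segment ℝ (D.pos u) (D.pos v)}

/-- The edges of the drawing can be represented by `k` (nondegenerate) line segments. A single
segment may represent several consecutive collinear edges. -/
def IsDrawnWithSegments (D : StraightLineDrawing G) (k : ℕ) : Prop :=
  ∃ a b : Fin k → ℝ × ℝ, (∀ i, a i ≠ b i) ∧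
    ⋃ i, segment ℝ (a i) (b i) = D.edgePoints

/-- All vertices lie on the integer grid `{0, …, W} × {0, …, H}`. -/
def IsOnGrid (D : StraightLineDrawing G) (W H : ℕ) : Prop :=
  ∀ v : V, ∃ x y : ℕ, x ≤ W ∧ y ≤ H ∧ D.pos v = ((x : ℝ), (y : ℝ))

end StraightLineDrawing

/-!
The drawing follows a decomposition of the tree into heavy paths. The tree is rooted at a leaf, and
at each vertex a child with the largest subtree is called straight. The edge to a straight child
prolongs the edge from the parent, so that the tree falls into straight paths, the spines, each of
which starts at a vertex with the edge to a child that is not straight (or at the root) and ends at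
a leaf. The spines that start at a vertex leave it in pairs of opposite directions `(m, 1)` and
`-(m, 1)`, in a frame whose first axis prolongs the edge from the parent; one of them stays single
if their number is odd. Two opposite spines form one segment. Counting the children of all vertices
shows that the segments are half as many as the vertices of odd degree
(`SpineLayout.two_mul_card_isSegmentStart`).

No drawing has fewer segments (`StraightLineDrawing.card_odd_degree_le`): close to a point that is
no end of a segment, the union of the segments is symmetric about the point. So the edges at a
vertex that is no end of a segment come in opposite pairs, and its degree is even.

For the absence of crossings, the subtree of a vertex together with the edge from its parent lies in
a flat cone with apex at the parent, cut off at a certain extent. The cones around the different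
rays at a vertex are disjoint (`turn_cone_ne`), and the edges are so long that the cones of the
children of a vertex stay in the cone of the vertex (`SpineLayout.region_subset_region_par`). Hence
the half-open edges, each taken without its end at the parent, are pairwise disjoint
(`SpineLayout.disjoint_halfEdge`), which gives everything that is asked of a drawing.

Turning the frame is unimodular, so no scaling is needed, and extents grow only because of the
lengths of the edges. Along a straight edge they are added; at any other child they are multiplied
by a number linear in `n`, but there the size of the subtree at least halves. With `s` as the size
of a subtree, the extent `s * (3 * n) ^ log₂ s` is therefore enough (`exists_spineLayout`).
-/

/-! ### Turned cones -/

/-- The linear maps by which the frames of the children of a vertex are turned against the frame of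
the vertex. Number `0` goes straight on; the numbers `2 * m + 1` and `2 * m + 2` send the first axis
to the opposite directions `(m + 1, 1)` and `-(m + 1, 1)`. All of them are unimodular. -/
noncomputable def turn : ℕ → ((ℝ × ℝ) →ₗ[ℝ] (ℝ × ℝ))
  | 0 => LinearMap.id
  | i + 1 => (-1 : ℝ) ^ i • LinearMap.prod
      (((i / 2 + 1 : ℕ) : ℝ) • LinearMap.fst ℝ ℝ ℝ + LinearMap.snd ℝ ℝ ℝ) (LinearMap.fst ℝ ℝ ℝ)

theorem turn_zero (p : ℝ × ℝ) : turn 0 p = p := rfl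

theorem turn_odd (m : ℕ) (p : ℝ × ℝ) : turn (2 * m + 1) p = ((m + 1) * p.1 + p.2, p.1) := by
  ext <;> simp [turn]

theorem turn_even (m : ℕ) (p : ℝ × ℝ) :
    turn (2 * m + 2) p = (-((m + 1) * p.1 + p.2), -p.1) := by
  have h : (2 * m + 1) / 2 = m := by omega
  ext <;> simp [turn, h, pow_succ]

theorem eq_zero_or_odd_or_even (i : ℕ) : i = 0 ∨ (∃ m, i = 2 * m + 1) ∨ ∃ m, i = 2 * m + 2 := by
  rcases i with _ | i
  · exact Or.inl rfl
  · rcases Nat.even_or_odd' i with ⟨m, rfl | rfl⟩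
    · exact Or.inr (Or.inl ⟨m, rfl⟩)
    · exact Or.inr (Or.inr ⟨m, rfl⟩)

theorem turn_injective (i : ℕ) : Function.Injective (turn i) := by
  rintro ⟨x, y⟩ ⟨x', y'⟩ h
  rcases eq_zero_or_odd_or_even i with rfl | ⟨m, rfl⟩ | ⟨m, rfl⟩
  · exact h
  · simp only [turn_odd, Prod.mk.injEq] at h
    obtain ⟨h1, rfl⟩ := h
    simpa using h1
  · simp only [turn_even, Prod.mk.injEq, neg_inj] at h
    obtain ⟨h1, rfl⟩ := h
    simpa using h1

/-- The open cone of slope `1 / K` around the positive first axis, cut off at abscissa `X`. -/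
def cone (K X : ℕ) : Set (ℝ × ℝ) := {p | K * |p.2| < p.1 ∧ p.1 ≤ X}

theorem cone_pos {K X : ℕ} {p : ℝ × ℝ} (hp : p ∈ cone K X) : 0 < p.1 :=
  lt_of_le_of_lt (by positivity) hp.1

theorem cone_mul_lt {K X : ℕ} {p : ℝ × ℝ} (hp : p ∈ cone K X) :
    K * p.2 < p.1 ∧ -p.1 < K * p.2 := by
  have h := hp.1
  rw [← abs_of_nonneg (Nat.cast_nonneg (α := ℝ) K), ← abs_mul, abs_lt] at h
  exact ⟨h.2, h.1⟩

theorem cone_abs_snd_lt {K X : ℕ} (hK : 1 ≤ K) {p : ℝ × ℝ} (hp : p ∈ cone K X) :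
    |p.2| < p.1 := by
  have hK' : (1 : ℝ) ≤ K := by exact_mod_cast hK
  nlinarith [hp.1, abs_nonneg p.2]

/-- The cones around two of the rays starting at a vertex are disjoint. -/
theorem turn_cone_ne {K X X' i i' : ℕ} (hi : i < K) (hi' : i' < K) (hne : i ≠ i') {p p' : ℝ × ℝ}
    (hp : p ∈ cone K X) (hp' : p' ∈ cone K X') : turn i p ≠ turn i' p' := by
  have hK : 2 ≤ K := by omega
  have hK' : (2 : ℝ) ≤ K := by exact_mod_cast hK
  have a1 := abs_lt.1 (cone_abs_snd_lt (by omega) hp)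
  have a2 := abs_lt.1 (cone_abs_snd_lt (by omega) hp')
  have b1 := cone_mul_lt hp
  have b2 := cone_mul_lt hp'
  have c1 := cone_pos hp
  have c2 := cone_pos hp'
  obtain ⟨x, y⟩ := p
  obtain ⟨x', y'⟩ := p'
  simp only at a1 a2 b1 b2 c1 c2
  intro h
  -- The straight cone is too flat to meet an upward one of index `2 * m + 1 < K`.
  have key : ∀ (m : ℕ) (x y u v : ℝ), 2 * m + 1 < K → 0 < x → y < x → K * v < u →
      ¬ (u = (m + 1) * x + y ∧ v = x) := by
    rintro m x y u v hm hx hy hu ⟨rfl, rfl⟩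
    have : (m : ℝ) + 2 ≤ K := by
      have : m + 2 ≤ K := by omega
      exact_mod_cast this
    nlinarith
  -- Two cones on the same side have axes that differ by at least one in slope.
  have key2 : ∀ (m m' : ℕ) (x y y' : ℝ), m < m' → 0 < x → K * y < x → -x < K * y' →
      (m + 1) * x + y ≠ (m' + 1) * x + y' := by
    intro m m' x y y' hm hx h1 h2 h3
    have : (m : ℝ) + 1 ≤ m' := by exact_mod_cast hm
    have h4 : x ≤ y - y' := by nlinarith
    nlinarith
  rcases eq_zero_or_odd_or_even i with rfl | ⟨m, rfl⟩ | ⟨m, rfl⟩ <;>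
  rcases eq_zero_or_odd_or_even i' with rfl | ⟨m', rfl⟩ | ⟨m', rfl⟩ <;>
  simp only [turn_zero, turn_odd, turn_even, Prod.mk.injEq] at h
  · exact hne rfl
  · exact key m' x' y' x y hi' c2 a2.2 b1.1 h
  · have : (0 : ℝ) ≤ m' := Nat.cast_nonneg _
    nlinarith
  · exact key m x y x' y' hi c1 a1.2 b2.1 ⟨h.1.symm, h.2.symm⟩
  · obtain ⟨h1, rfl⟩ := h
    rcases lt_trichotomy m m' with h | rfl | h
    · exact key2 m m' x y y' h c1 b1.1 b2.2 h1
    · exact hne rfl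
    · exact key2 m' m x y' y h c1 b2.1 b1.2 h1.symm
  · linarith
  · have : (0 : ℝ) ≤ m := Nat.cast_nonneg _
    nlinarith
  · linarith
  · obtain ⟨h1, h2⟩ := h
    obtain rfl := neg_inj.1 h2
    have h1 := neg_inj.1 h1
    rcases lt_trichotomy m m' with h | rfl | h
    · exact key2 m m' x y y' h c1 b1.1 b2.2 h1
    · exact hne rfl
    · exact key2 m' m x y' y h c1 b2.1 b1.2 h1.symm

/-- No cone at a vertex meets the ray along which the vertex is reached. -/
theorem turn_cone_ne_ray {K X i : ℕ} {p : ℝ × ℝ} (hp : p ∈ cone K X) {t : ℝ} (ht : t ≤ 0) :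
    turn i p ≠ (t, 0) := by
  have c1 := cone_pos hp
  intro h
  rcases eq_zero_or_odd_or_even i with rfl | ⟨m, rfl⟩ | ⟨m, rfl⟩ <;>
  simp only [turn_zero, turn_odd, turn_even, Prod.ext_iff] at h <;> linarith [h.1, h.2]

theorem add_cone_subset {K X X' D : ℕ} (h : D + X ≤ X') {p : ℝ × ℝ} (hp : p ∈ cone K X) :
    ((D : ℝ), (0 : ℝ)) + p ∈ cone K X' := by
  have h' : (D : ℝ) + X ≤ X' := by exact_mod_cast h
  have := hp.1
  have := hp.2
  have : (0 : ℝ) ≤ D := Nat.cast_nonneg _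
  constructor
  · simp only [Prod.snd_add, Prod.fst_add, zero_add]
    linarith
  · simp only [Prod.fst_add]
    linarith

/-- A step that is long against the bounded cone of a turned child keeps this cone inside the flat
cone that starts before the step. -/
theorem add_turn_cone_subset {K X X' D i : ℕ} (hi : i < K) (hi0 : i ≠ 0) (h1 : 2 * K * X ≤ D)
    (h2 : D + K * X ≤ X') {p : ℝ × ℝ} (hp : p ∈ cone K X) :
    ((D : ℝ), (0 : ℝ)) + turn i p ∈ cone K X' := by
  have h1' : 2 * (K : ℝ) * X ≤ D := by exact_mod_cast h1
  have h2' : (D : ℝ) + K * X ≤ X' := by exact_mod_cast h2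
  have c := cone_pos hp
  have a := abs_lt.1 (cone_abs_snd_lt (by omega) hp)
  have hX := hp.2
  obtain ⟨x, y⟩ := p
  simp only at c a hX
  have hK0 : (0 : ℝ) ≤ K := Nat.cast_nonneg _
  have hKx : K * x ≤ K * X := mul_le_mul_of_nonneg_left hX hK0
  have key : ∀ m : ℕ, m + 2 ≤ K → 0 < (m + 1) * x + y ∧ (m + 1) * x + y < K * x := by
    intro m hm
    have h3 : (m : ℝ) + 2 ≤ K := by exact_mod_cast hm
    have h4 : (0 : ℝ) ≤ m := Nat.cast_nonneg _
    constructor <;> nlinarith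
  rcases eq_zero_or_odd_or_even i with rfl | ⟨m, rfl⟩ | ⟨m, rfl⟩
  · exact absurd rfl hi0
  · obtain ⟨k1, k2⟩ := key m (by omega)
    constructor
    · simp only [turn_odd, Prod.snd_add, Prod.fst_add, zero_add, abs_of_pos c]
      linarith
    · simp only [turn_odd, Prod.fst_add]
      linarith
  · obtain ⟨k1, k2⟩ := key m (by omega)
    constructor
    · simp only [turn_even, Prod.snd_add, Prod.fst_add, zero_add, abs_neg, abs_of_pos c]
      linarith
    · simp only [turn_even, Prod.fst_add]
      nlinarith

/-- The points of the plane with integer coordinates. -/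
def integerPoints : Set (ℝ × ℝ) := {p | ∃ x y : ℤ, p = ((x : ℝ), (y : ℝ))}

theorem turn_mem_integerPoints (i : ℕ) {p : ℝ × ℝ} (hp : p ∈ integerPoints) :
    turn i p ∈ integerPoints := by
  obtain ⟨x, y, rfl⟩ := hp
  rcases eq_zero_or_odd_or_even i with rfl | ⟨m, rfl⟩ | ⟨m, rfl⟩
  · exact ⟨x, y, rfl⟩
  · exact ⟨(m + 1) * x + y, x, by rw [turn_odd]; push_cast; rfl⟩
  · exact ⟨-((m + 1) * x + y), -x, by rw [turn_even]; push_cast; rfl⟩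

/-! ### The drawing of a rooted tree -/

/-- A rooted tree together with the numbers from which its drawing is computed. The children of a
vertex are numbered from `0` on, and the edge to a vertex `v` from its parent has length `step v`
in a frame at the parent, turned according to the number of `v`. The values of `par`, `idx`, `step`
and `reach` at the root mean nothing. -/
structure SpineLayout (V : Type*) where
  /-- the root -/
  root : V
  /-- the parent of a vertex -/
  par : V → V
  /-- the distance from the root -/
  depth : V → ℕ
  depth_root : depth root = 0
  depth_eq : ∀ v, v ≠ root → depth v = depth (par v) + 1
  /-- the number of a vertex among the children of its parent -/
  idx : V → ℕ
  idx_inj : ∀ u v, u ≠ root → v ≠ root → par u = par v → idx u = idx v → u = v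
  idx_pred : ∀ v, v ≠ root → ∀ i, idx v = i + 1 → ∃ u, u ≠ root ∧ par u = par v ∧ idx u = i
  idx_root_child : ∀ v, v ≠ root → par v = root → idx v = 0
  /-- the flatness of the cones -/
  flat : ℕ
  idx_lt : ∀ v, v ≠ root → idx v < flat
  /-- the length of the edge from the parent -/
  step : V → ℕ
  /-- a bound on the extent of the drawing of the subtree at `v` and the edge from its parent -/
  reach : V → ℕ
  step_pos : ∀ v, v ≠ root → 0 < step v
  step_le_reach : ∀ v, v ≠ root → step v ≤ reach v
  reach_spine : ∀ v, v ≠ root → par v ≠ root → idx v = 0 → step (par v) + reach v ≤ reach (par v)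
  le_step : ∀ v, v ≠ root → par v ≠ root → idx v ≠ 0 → 2 * flat * reach v ≤ step (par v)
  reach_turned : ∀ v, v ≠ root → par v ≠ root → idx v ≠ 0 →
    step (par v) + flat * reach v ≤ reach (par v)
  /-- the height of the root, large enough to keep all ordinates nonnegative -/
  shift : ℕ
  reach_le_shift : ∀ v, v ≠ root → reach v ≤ shift

/-- The segment from `a` to `b` without the end `a`. -/
def halfOpenSegment (a b : ℝ × ℝ) : Set (ℝ × ℝ) := AffineMap.lineMap a b '' Set.Ioc (0 : ℝ) 1

theorem image_halfOpenSegment (f : (ℝ × ℝ) →ᵃ[ℝ] (ℝ × ℝ)) (a b : ℝ × ℝ) :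
    f '' halfOpenSegment a b = halfOpenSegment (f a) (f b) := by
  unfold halfOpenSegment
  rw [Set.image_image]
  exact Set.image_congr fun t _ => AffineMap.apply_lineMap f a b t

theorem right_mem_halfOpenSegment (a b : ℝ × ℝ) : b ∈ halfOpenSegment a b :=
  ⟨1, by simp, by simp⟩

theorem openSegment_subset_halfOpenSegment (a b : ℝ × ℝ) :
    openSegment ℝ a b ⊆ halfOpenSegment a b := by
  rw [openSegment_eq_image_lineMap]
  exact Set.image_mono Set.Ioo_subset_Ioc_self

theorem eq_or_mem_halfOpenSegment {a b x : ℝ × ℝ} (h : x ∈ segment ℝ a b) :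
    x = a ∨ x ∈ halfOpenSegment a b := by
  rw [segment_eq_image_lineMap] at h
  obtain ⟨t, ⟨h0, h1⟩, rfl⟩ := h
  rcases h0.eq_or_lt with rfl | h0
  · left; simp
  · exact Or.inr ⟨t, ⟨h0, h1⟩, rfl⟩

namespace SpineLayout

variable {V : Type*} (L : SpineLayout V)

/-- The frame at a vertex of depth `n`, by recursion on `n`. -/
noncomputable def frameAux : ℕ → V → ((ℝ × ℝ) →ᵃ[ℝ] (ℝ × ℝ))
  | 0, _ => (AffineEquiv.constVAdd ℝ (ℝ × ℝ) ((0 : ℝ), (L.shift : ℝ))).toAffineMap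
  | n + 1, v => ((frameAux n (L.par v)).comp (turn (L.idx v)).toAffineMap).comp
      (AffineEquiv.constVAdd ℝ (ℝ × ℝ) ((L.step v : ℝ), (0 : ℝ))).toAffineMap

/-- The frame at a vertex, with the vertex as its origin and, except at the root, the first axis
prolonging the edge from the parent. -/
noncomputable def frame (v : V) : (ℝ × ℝ) →ᵃ[ℝ] (ℝ × ℝ) := L.frameAux (L.depth v) v

/-- The frame at the parent of `v`, turned so that its first axis points to `v`. -/
noncomputable def arm (v : V) : (ℝ × ℝ) →ᵃ[ℝ] (ℝ × ℝ) :=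
  (L.frame (L.par v)).comp (turn (L.idx v)).toAffineMap

/-- The position of a vertex in the drawing. -/
noncomputable def position (v : V) : ℝ × ℝ := L.frame v 0

/-- The cone that contains the subtree at `v` and the edge to `v`, except for its starting point. -/
def region (v : V) : Set (ℝ × ℝ) := L.arm v '' cone L.flat (L.reach v)

/-- The edge to `v` from its parent, without the parent. -/
def halfEdge (v : V) : Set (ℝ × ℝ) := halfOpenSegment (L.position (L.par v)) (L.position v)

theorem frame_root (p : ℝ × ℝ) : L.frame L.root p = ((0 : ℝ), (L.shift : ℝ)) + p := by
  simp [frame, L.depth_root, frameAux]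

theorem arm_apply (v : V) (p : ℝ × ℝ) : L.arm v p = L.frame (L.par v) (turn (L.idx v) p) := rfl

theorem frame_apply {v : V} (hv : v ≠ L.root) (p : ℝ × ℝ) :
    L.frame v p = L.arm v (((L.step v : ℝ), (0 : ℝ)) + p) := by
  simp only [frame, L.depth_eq v hv, frameAux, arm]
  rfl

theorem position_eq {v : V} (hv : v ≠ L.root) : L.position v = L.arm v ((L.step v : ℝ), 0) := by
  rw [position, L.frame_apply hv, add_zero]

theorem position_par (v : V) : L.position (L.par v) = L.arm v 0 := by
  rw [position, arm_apply, (turn (L.idx v)).map_zero]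

theorem depth_pos {v : V} (hv : v ≠ L.root) : 0 < L.depth v := by
  rw [L.depth_eq v hv]
  exact Nat.succ_pos _

theorem ne_root_of_depth_pos {v : V} (h : 0 < L.depth v) : v ≠ L.root := by
  rintro rfl
  rw [L.depth_root] at h
  exact lt_irrefl _ h

theorem eq_root_of_depth {v : V} (h : L.depth v = 0) : v = L.root := by
  by_contra hv
  exact (L.depth_pos hv).ne' h

theorem frame_injective (v : V) : Function.Injective (L.frame v) := by
  induction h : L.depth v generalizing v with
  | zero =>
    obtain rfl := L.eq_root_of_depth h
    intro p q hpq
    simpa only [frame_root, add_right_inj] using hpq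
  | succ n ih =>
    have hv : v ≠ L.root := L.ne_root_of_depth_pos (by omega)
    have hp := ih (L.par v) (by have := L.depth_eq v hv; omega)
    intro p q hpq
    simp only [L.frame_apply hv, arm_apply] at hpq
    exact add_left_cancel (turn_injective _ (hp hpq))

theorem arm_injective (v : V) : Function.Injective (L.arm v) :=
  (L.frame_injective _).comp (turn_injective _)

theorem frame_mem_integerPoints (v : V) {p : ℝ × ℝ} (hp : p ∈ integerPoints) :
    L.frame v p ∈ integerPoints := by
  induction h : L.depth v generalizing v p with
  | zero =>
    obtain rfl := L.eq_root_of_depth h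
    obtain ⟨x, y, rfl⟩ := hp
    exact ⟨x, L.shift + y, by rw [frame_root]; ext <;> simp⟩
  | succ n ih =>
    have hv : v ≠ L.root := L.ne_root_of_depth_pos (by omega)
    rw [L.frame_apply hv, arm_apply]
    refine ih (L.par v) (turn_mem_integerPoints _ ?_) (by have := L.depth_eq v hv; omega)
    obtain ⟨x, y, rfl⟩ := hp
    exact ⟨L.step v + x, y, by ext <;> simp⟩

theorem halfEdge_eq {v : V} (hv : v ≠ L.root) :
    L.halfEdge v = L.arm v '' halfOpenSegment 0 ((L.step v : ℝ), 0) := by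
  rw [halfEdge, image_halfOpenSegment, L.position_par, L.position_eq hv]

theorem halfEdge_subset_region {v : V} (hv : v ≠ L.root) : L.halfEdge v ⊆ L.region v := by
  rw [L.halfEdge_eq hv]
  refine Set.image_mono ?_
  rintro _ ⟨t, ⟨h0, h1⟩, rfl⟩
  have hs : (0 : ℝ) < L.step v := by exact_mod_cast L.step_pos v hv
  have hr : (L.step v : ℝ) ≤ L.reach v := by exact_mod_cast L.step_le_reach v hv
  have e : AffineMap.lineMap (0 : ℝ × ℝ) ((L.step v : ℝ), (0 : ℝ)) t = (t * L.step v, 0) := by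
    simp [AffineMap.lineMap_apply]
  rw [e]
  constructor
  · simpa using mul_pos h0 hs
  · simp only
    nlinarith

theorem position_mem_region {v : V} (hv : v ≠ L.root) : L.position v ∈ L.region v :=
  L.halfEdge_subset_region hv (right_mem_halfOpenSegment _ _)

theorem region_subset_region_par {v : V} (hv : v ≠ L.root) (hp : L.par v ≠ L.root) :
    L.region v ⊆ L.region (L.par v) := by
  rintro _ ⟨p, hpc, rfl⟩
  rw [arm_apply, L.frame_apply hp]
  refine Set.mem_image_of_mem _ ?_
  by_cases hi : L.idx v = 0
  · rw [hi, turn_zero]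
    exact add_cone_subset (L.reach_spine v hv hp hi) hpc
  · exact add_turn_cone_subset (L.idx_lt v hv) hi (L.le_step v hv hp hi)
      (L.reach_turned v hv hp hi) hpc

theorem disjoint_region_of_par_eq {u v : V} (hu : u ≠ L.root) (hv : v ≠ L.root)
    (hpar : L.par u = L.par v) (huv : u ≠ v) : Disjoint (L.region u) (L.region v) := by
  rw [Set.disjoint_left]
  rintro _ ⟨p, hp, rfl⟩ ⟨q, hq, h⟩
  rw [arm_apply, arm_apply, hpar] at h
  refine turn_cone_ne (L.idx_lt v hv) (L.idx_lt u hu) (fun hi => huv ?_) hq hp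
    (L.frame_injective _ h)
  exact L.idx_inj u v hu hv hpar hi.symm

theorem disjoint_region_of_depth_eq {u v : V} (hu : u ≠ L.root) (hv : v ≠ L.root)
    (hd : L.depth u = L.depth v) (huv : u ≠ v) : Disjoint (L.region u) (L.region v) := by
  induction h : L.depth u generalizing u v with
  | zero => exact absurd (L.eq_root_of_depth h) hu
  | succ n ih =>
    by_cases hpar : L.par u = L.par v
    · exact L.disjoint_region_of_par_eq hu hv hpar huv
    · have h1 := L.depth_eq u hu
      have h2 := L.depth_eq v hv
      have hpu : L.par u ≠ L.root := by
        intro h0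
        refine hpar (h0.trans (L.eq_root_of_depth ?_).symm)
        rw [h0, L.depth_root] at h1
        omega
      have hpv : L.par v ≠ L.root := by
        intro h0
        refine hpar ((L.eq_root_of_depth ?_).trans h0.symm)
        rw [h0, L.depth_root] at h2
        omega
      exact (ih hpu hpv (by omega) hpar (by omega)).mono (L.region_subset_region_par hu hpu)
        (L.region_subset_region_par hv hpv)

theorem disjoint_halfEdge_par_region {v : V} (hp : L.par v ≠ L.root) :
    Disjoint (L.halfEdge (L.par v)) (L.region v) := by
  rw [Set.disjoint_left, L.halfEdge_eq hp]
  rintro _ ⟨_, ⟨t, ⟨h0, h1⟩, rfl⟩, rfl⟩ ⟨q, hq, h⟩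
  have hs : (0 : ℝ) ≤ L.step (L.par v) := Nat.cast_nonneg _
  rw [arm_apply, L.frame_apply hp] at h
  have h := L.arm_injective _ h
  refine turn_cone_ne_ray (i := L.idx v) hq (t := (t - 1) * L.step (L.par v)) (by nlinarith) ?_
  rw [eq_sub_of_add_eq' h, AffineMap.lineMap_apply]
  ext <;> simp
  ring

theorem disjoint_halfEdge_region {u v : V} (hu : u ≠ L.root) (hv : v ≠ L.root)
    (hd : L.depth u < L.depth v) : Disjoint (L.halfEdge u) (L.region v) := by
  induction h : L.depth v generalizing v with
  | zero => omega
  | succ n ih =>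
    have h1 := L.depth_eq v hv
    have hpv : L.par v ≠ L.root := by
      have := L.depth_pos hu
      exact L.ne_root_of_depth_pos (by omega)
    rcases eq_or_ne u (L.par v) with rfl | hne
    · exact L.disjoint_halfEdge_par_region hpv
    · have hsub := L.region_subset_region_par hv hpv
      rcases lt_or_eq_of_le (show L.depth u ≤ L.depth (L.par v) by omega) with hlt | heq
      · exact (ih hpv hlt (by omega)).mono_right hsub
      · exact (L.disjoint_region_of_depth_eq hu hpv heq hne).mono (L.halfEdge_subset_region hu) hsub

/-- Freedom of crossings, in the form that also separates the vertices. -/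
theorem disjoint_halfEdge {u v : V} (hu : u ≠ L.root) (hv : v ≠ L.root) (huv : u ≠ v) :
    Disjoint (L.halfEdge u) (L.halfEdge v) := by
  rcases lt_trichotomy (L.depth u) (L.depth v) with h | h | h
  · exact (L.disjoint_halfEdge_region hu hv h).mono_right (L.halfEdge_subset_region hv)
  · exact (L.disjoint_region_of_depth_eq hu hv h huv).mono (L.halfEdge_subset_region hu)
      (L.halfEdge_subset_region hv)
  · exact ((L.disjoint_halfEdge_region hv hu h).mono_right (L.halfEdge_subset_region hu)).symm

/-- All of the drawing lies in the cone at the root. -/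
theorem region_subset_frame_root {v : V} (hv : v ≠ L.root) :
    L.region v ⊆ L.frame L.root '' cone L.flat L.shift := by
  induction h : L.depth v generalizing v with
  | zero => exact absurd (L.eq_root_of_depth h) hv
  | succ n ih =>
    by_cases hp : L.par v = L.root
    · rintro _ ⟨p, hpc, rfl⟩
      rw [arm_apply, hp, L.idx_root_child v hv hp, turn_zero]
      exact ⟨p, ⟨hpc.1, hpc.2.trans (by exact_mod_cast L.reach_le_shift v hv)⟩, rfl⟩
    · exact (L.region_subset_region_par hv hp).trans
        (ih hp (by have := L.depth_eq v hv; omega))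

theorem position_root_notMem {v : V} (hv : v ≠ L.root) : L.position L.root ∉ L.halfEdge v := by
  intro h
  obtain ⟨p, hp, h⟩ := L.region_subset_frame_root hv (L.halfEdge_subset_region hv h)
  have := cone_pos hp
  rw [L.frame_injective _ h] at this
  exact lt_irrefl _ this

theorem position_mem_halfEdge {u v : V} (hv : v ≠ L.root)
    (h : L.position u ∈ L.halfEdge v) : u = v := by
  by_contra huv
  have hu : u ≠ L.root := by
    rintro rfl
    exact L.position_root_notMem hv h
  exact (L.disjoint_halfEdge hu hv huv).notMem_of_mem_left (right_mem_halfOpenSegment _ _) h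

theorem position_injective : Function.Injective L.position := by
  intro u v h
  by_cases hv : v = L.root
  · by_cases hu : u = L.root
    · rw [hu, hv]
    · refine (L.position_mem_halfEdge hu ?_).symm
      rw [← h]
      exact right_mem_halfOpenSegment _ _
  · refine L.position_mem_halfEdge hv ?_
    rw [h]
    exact right_mem_halfOpenSegment _ _

theorem exists_nat_position (v : V) : ∃ x y : ℕ, x ≤ 2 * L.shift ∧ y ≤ 2 * L.shift ∧
    L.position v = ((x : ℝ), (y : ℝ)) := by
  by_cases hv : v = L.root
  · subst hv
    exact ⟨0, L.shift, by omega, by omega, by rw [position, frame_root]; simp⟩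
  · obtain ⟨x, y, h⟩ := L.frame_mem_integerPoints v (p := 0) ⟨0, 0, by simp; rfl⟩
    obtain ⟨p, hp, h'⟩ := L.region_subset_frame_root hv (L.position_mem_region hv)
    have hK : 1 ≤ L.flat := by have := L.idx_lt v hv; omega
    have a := abs_lt.1 (cone_abs_snd_lt hK hp)
    have b := hp.2
    rw [frame_root, position, h, Prod.ext_iff] at h'
    simp only [Prod.fst_add, Prod.snd_add, zero_add] at h'
    have x0 : (0 : ℝ) < x := by linarith [cone_pos hp]
    have x1 : (x : ℝ) ≤ L.shift := by linarith
    have y0 : (0 : ℝ) ≤ y := by linarith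
    have y1 : (y : ℝ) ≤ 2 * L.shift := by linarith
    norm_cast at x0 x1 y0 y1
    lift x to ℕ using x0.le
    lift y to ℕ using y0
    exact ⟨x, y, by omega, by omega, by rw [position, h]; simp⟩

variable {L}

/-- The layout of a tree, as a drawing of the graph of that tree. -/
noncomputable def drawing {G : SimpleGraph V}
    (hG : ∀ u v, G.Adj u v ↔ (u ≠ L.root ∧ L.par u = v) ∨ (v ≠ L.root ∧ L.par v = u)) :
    StraightLineDrawing G where
  pos := L.position
  pos_injective := L.position_injective
  vertex_not_on_edge u v w h hw := by
    have key : ∀ v, v ≠ L.root → ∀ w,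
        L.position w ∈ segment ℝ (L.position (L.par v)) (L.position v) → w = L.par v ∨ w = v :=
      fun v hv w hw => (eq_or_mem_halfOpenSegment hw).imp (fun h => L.position_injective h)
        (L.position_mem_halfEdge hv)
    rcases (hG u v).1 h with ⟨hu, rfl⟩ | ⟨hv, rfl⟩
    · rw [segment_symm] at hw
      exact (key u hu w hw).symm
    · exact key v hv w hw
  edges_disjoint u v u' v' h h' hne := by
    have key : ∀ u v, G.Adj u v → ∃ w, w ≠ L.root ∧ s(u, v) = s(L.par w, w) ∧
        openSegment ℝ (L.position u) (L.position v) ⊆ L.halfEdge w := by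
      intro u v h
      rcases (hG u v).1 h with ⟨hu, rfl⟩ | ⟨hv, rfl⟩
      · refine ⟨u, hu, Sym2.eq_swap, ?_⟩
        rw [openSegment_symm]
        exact openSegment_subset_halfOpenSegment _ _
      · exact ⟨v, hv, rfl, openSegment_subset_halfOpenSegment _ _⟩
    obtain ⟨w, hw, e, hs⟩ := key u v h
    obtain ⟨w', hw', e', hs'⟩ := key u' v' h'
    refine (L.disjoint_halfEdge hw hw' ?_).mono hs hs'
    rintro rfl
    exact hne (e.trans e'.symm)

end SpineLayout

/-! ### Spines and segments -/

/-- The segment from the origin to `(l, 0)`. -/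
def bar (l : ℝ) : Set (ℝ × ℝ) := {p | 0 ≤ p.1 ∧ p.1 ≤ l ∧ p.2 = 0}

theorem bar_eq_segment {l : ℝ} (hl : 0 < l) : bar l = segment ℝ 0 (l, (0 : ℝ)) := by
  rw [segment_eq_image_lineMap]
  ext ⟨x, y⟩
  constructor
  · rintro ⟨h0, h1, rfl : y = 0⟩
    refine ⟨x / l, ⟨div_nonneg h0 hl.le, (div_le_one hl).2 h1⟩, ?_⟩
    simp [AffineMap.lineMap_apply, hl.ne']
  · rintro ⟨t, ⟨h0, h1⟩, h⟩
    simp only [AffineMap.lineMap_apply, vsub_eq_sub, sub_zero, Prod.smul_mk, smul_eq_mul, mul_zero,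
      vadd_eq_add, add_zero, Prod.mk.injEq] at h
    obtain ⟨rfl, rfl⟩ := h
    refine ⟨by positivity, ?_, rfl⟩
    simp only
    nlinarith

theorem segment_union_segment {a b z : ℝ × ℝ} (hz : z ∈ segment ℝ a b) :
    segment ℝ a b = segment ℝ a z ∪ segment ℝ z b := by
  rw [segment_eq_image_lineMap] at hz
  obtain ⟨s, ⟨h0, h1⟩, rfl⟩ := hz
  have e0 : segment ℝ a (AffineMap.lineMap a b s) = AffineMap.lineMap a b '' Set.Icc 0 s := by
    rw [← segment_eq_Icc h0, image_segment, AffineMap.lineMap_apply_zero]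
  have e1 : segment ℝ (AffineMap.lineMap a b s) b = AffineMap.lineMap a b '' Set.Icc s 1 := by
    rw [← segment_eq_Icc h1, image_segment, AffineMap.lineMap_apply_one]
  rw [e0, e1, ← Set.image_union, Set.Icc_union_Icc_eq_Icc h0 h1, segment_eq_image_lineMap]

namespace SpineLayout

variable {V : Type*} (L : SpineLayout V)

/-- The straight child of a vertex, the one with number `0`, if the vertex has children. -/
def IsStraightChild (h v : V) : Prop := h ≠ L.root ∧ L.par h = v ∧ L.idx h = 0

open Classical in
/-- The length of the path of `n` straight edges that starts with the edge to `v`; the path ends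
earlier if it comes to a leaf. -/
noncomputable def spineLengthAux : ℕ → V → ℕ
  | 0, _ => 0
  | n + 1, v => L.step v +
      if h : ∃ u, L.IsStraightChild u v then spineLengthAux n h.choose else 0

/-- The points of the edge to `v` from its parent. -/
def edge (v : V) : Set (ℝ × ℝ) := segment ℝ (L.position (L.par v)) (L.position v)

theorem edge_eq {v : V} (hv : v ≠ L.root) : L.edge v = L.arm v '' bar (L.step v) := by
  rw [edge, bar_eq_segment (by exact_mod_cast L.step_pos v hv), image_segment, L.position_par,
    L.position_eq hv]

/-- The vertices whose spines do not prolong another spine, and of two opposite spines only the one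
with the smaller number. -/
def IsSegmentStart (v : V) : Prop := v ≠ L.root ∧ (L.par v = L.root ∨ Odd (L.idx v))

/-- The spine of `u` starts at the same vertex as the spine of `v` and in the opposite direction, if
the number of `v` is odd. -/
def IsPartner (u v : V) : Prop := u ≠ L.root ∧ L.par u = L.par v ∧ L.idx u = L.idx v + 1

theorem odd_idx_of_isPartner {u v : V} (hv : L.IsSegmentStart v) (hu : L.IsPartner u v) :
    ∃ m, L.idx v = 2 * m + 1 ∧ L.idx u = 2 * m + 2 := by
  rcases hv.2 with h | ⟨m, h⟩
  · have h1 := L.idx_root_child u hu.1 (hu.2.1.trans h)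
    have h2 := hu.2.2
    omega
  · exact ⟨m, h, by rw [hu.2.2, h]⟩

variable [Fintype V]

/-- The length of the spine of `v`: the straight path from the parent of `v` through `v` and on
through straight children to a leaf. -/
noncomputable def spineLength (v : V) : ℕ :=
  L.spineLengthAux (Finset.univ.sup L.depth + 1 - L.depth v) v

theorem depth_le_sup (v : V) : L.depth v ≤ Finset.univ.sup L.depth :=
  Finset.le_sup (Finset.mem_univ v)

theorem spineLength_of_isStraightChild {h v : V} (hh : L.IsStraightChild h v) :
    L.spineLength v = L.step v + L.spineLength h := by
  have hex : ∃ u, L.IsStraightChild u v := ⟨h, hh⟩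
  have hu : hex.choose = h := L.idx_inj _ _ hex.choose_spec.1 hh.1
    (hex.choose_spec.2.1.trans hh.2.1.symm) (hex.choose_spec.2.2.trans hh.2.2.symm)
  have h1 := L.depth_le_sup h
  have h2 := L.depth_eq h hh.1
  rw [hh.2.1] at h2
  rw [spineLength, show Finset.univ.sup L.depth + 1 - L.depth v =
    (Finset.univ.sup L.depth + 1 - L.depth h) + 1 by omega, spineLengthAux, dif_pos hex, hu,
    spineLength]

theorem spineLength_of_not {v : V} (hv : ¬ ∃ u, L.IsStraightChild u v) :
    L.spineLength v = L.step v := by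
  have h1 := L.depth_le_sup v
  rw [spineLength, show Finset.univ.sup L.depth + 1 - L.depth v =
    (Finset.univ.sup L.depth - L.depth v) + 1 by omega, spineLengthAux, dif_neg hv, add_zero]

theorem step_le_spineLength (v : V) : L.step v ≤ L.spineLength v := by
  by_cases h : ∃ u, L.IsStraightChild u v
  · obtain ⟨u, hu⟩ := h
    rw [L.spineLength_of_isStraightChild hu]
    exact Nat.le_add_right _ _
  · rw [L.spineLength_of_not h]

theorem spineLength_pos {v : V} (hv : v ≠ L.root) : (0 : ℝ) < L.spineLength v := by
  exact_mod_cast (L.step_pos v hv).trans_le (L.step_le_spineLength v)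

/-- The end of the spine of `v`. -/
noncomputable def tip (v : V) : ℝ × ℝ := L.arm v ((L.spineLength v : ℝ), 0)

/-- The points of the spine of `v`. -/
def spine (v : V) : Set (ℝ × ℝ) := L.arm v '' bar (L.spineLength v)

theorem spine_eq {v : V} (hv : v ≠ L.root) :
    L.spine v = segment ℝ (L.tip v) (L.position (L.par v)) := by
  rw [spine, bar_eq_segment (L.spineLength_pos hv), image_segment, L.position_par, segment_symm, tip]

theorem edge_subset_spine {v : V} (hv : v ≠ L.root) : L.edge v ⊆ L.spine v := by
  rw [L.edge_eq hv]
  refine Set.image_mono fun p hp => ⟨hp.1, hp.2.1.trans ?_, hp.2.2⟩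
  exact_mod_cast L.step_le_spineLength v

theorem spine_eq_union {h v : V} (hv : v ≠ L.root) (hh : L.IsStraightChild h v) :
    L.spine v = L.edge v ∪ L.spine h := by
  have hs : L.spine h = L.arm v '' ((fun p => ((L.step v : ℝ), (0 : ℝ)) + p) ''
      bar (L.spineLength h)) := by
    rw [spine, Set.image_image]
    refine Set.image_congr fun p _ => ?_
    rw [arm_apply, hh.2.1, hh.2.2, turn_zero, L.frame_apply hv]
  rw [L.edge_eq hv, hs, ← Set.image_union, spine, L.spineLength_of_isStraightChild hh]
  congr 1
  ext ⟨x, y⟩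
  have h0 : (0 : ℝ) ≤ L.step v := Nat.cast_nonneg _
  have h1 : (0 : ℝ) ≤ L.spineLength h := Nat.cast_nonneg _
  constructor
  · rintro ⟨hx0, hx1, hy : y = 0⟩
    simp only [Nat.cast_add] at hx0 hx1
    rcases le_total x (L.step v) with hx | hx
    · exact Or.inl ⟨hx0, hx, hy⟩
    · exact Or.inr ⟨(x - L.step v, y), ⟨sub_nonneg.2 hx, by simp only; linarith, hy⟩,
        by ext <;> simp⟩
  · rintro (⟨hx0, hx1, hy : y = 0⟩ | ⟨⟨x', y'⟩, ⟨hx0, hx1, hy : y' = 0⟩, h⟩)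
    · simp only at hx0 hx1
      exact ⟨hx0, by simp only [Nat.cast_add]; linarith, hy⟩
    · simp only [Prod.mk_add_mk, Prod.mk.injEq, zero_add] at h hx0 hx1
      exact ⟨by simp only; linarith, by simp only [Nat.cast_add]; linarith, h.2.symm.trans hy⟩

theorem spine_subset_iUnion_edge {v : V} (hv : v ≠ L.root) :
    L.spine v ⊆ ⋃ w ∈ {w | w ≠ L.root}, L.edge w := by
  induction h : Finset.univ.sup L.depth - L.depth v generalizing v with
  | zero =>
    have hn : ¬ ∃ u, L.IsStraightChild u v := by
      rintro ⟨u, hu⟩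
      have h1 := L.depth_le_sup u
      have h2 := L.depth_eq u hu.1
      rw [hu.2.1] at h2
      omega
    rw [spine, L.spineLength_of_not hn, ← L.edge_eq hv]
    exact Set.subset_biUnion_of_mem (u := L.edge) (s := {w | w ≠ L.root}) hv
  | succ n ih =>
    have he : L.edge v ⊆ ⋃ w ∈ {w | w ≠ L.root}, L.edge w :=
      Set.subset_biUnion_of_mem (u := L.edge) (s := {w | w ≠ L.root}) hv
    by_cases hex : ∃ u, L.IsStraightChild u v
    · obtain ⟨u, hu⟩ := hex
      have h2 := L.depth_eq u hu.1
      rw [hu.2.1] at h2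
      rw [L.spine_eq_union hv hu]
      exact Set.union_subset he (ih hu.1 (by omega))
    · rw [spine, L.spineLength_of_not hex, ← L.edge_eq hv]
      exact he

open Classical in
/-- The second end of the segment that starts at the tip of `v`. -/
noncomputable def farEnd (v : V) : ℝ × ℝ :=
  if h : ∃ u, L.IsPartner u v then L.tip h.choose else L.position (L.par v)

theorem farEnd_of_isPartner {u v : V} (hu : L.IsPartner u v) : L.farEnd v = L.tip u := by
  have hex : ∃ u, L.IsPartner u v := ⟨u, hu⟩
  rw [farEnd, dif_pos hex, L.idx_inj _ _ hex.choose_spec.1 hu.1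
    (hex.choose_spec.2.1.trans hu.2.1.symm) (hex.choose_spec.2.2.trans hu.2.2.symm)]

theorem farEnd_of_not {v : V} (h : ¬ ∃ u, L.IsPartner u v) :
    L.farEnd v = L.position (L.par v) := by
  rw [farEnd, dif_neg h]

theorem tip_ne_farEnd {v : V} (hv : L.IsSegmentStart v) : L.tip v ≠ L.farEnd v := by
  have hl := L.spineLength_pos hv.1
  by_cases hex : ∃ u, L.IsPartner u v
  · obtain ⟨u, hu⟩ := hex
    obtain ⟨m, h1, h2⟩ := L.odd_idx_of_isPartner hv hu
    have hl' := L.spineLength_pos hu.1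
    rw [L.farEnd_of_isPartner hu, tip, tip, arm_apply, arm_apply, hu.2.1, h1, h2, turn_odd,
      turn_even]
    intro h
    have := congrArg Prod.snd (L.frame_injective _ h)
    simp only at this
    linarith
  · rw [L.farEnd_of_not hex, L.position_par, tip]
    intro h
    have := congrArg Prod.fst (L.arm_injective _ h)
    simp only [Prod.fst_zero] at this
    linarith

theorem segment_tip_farEnd_of_isPartner {u v : V} (hv : L.IsSegmentStart v)
    (hu : L.IsPartner u v) :
    segment ℝ (L.tip v) (L.farEnd v) = L.spine v ∪ L.spine u := by
  obtain ⟨m, h1, h2⟩ := L.odd_idx_of_isPartner hv hu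
  have hl := L.spineLength_pos hv.1
  have hl' := L.spineLength_pos hu.1
  rw [L.farEnd_of_isPartner hu, L.spine_eq hv.1, L.spine_eq hu.1, hu.2.1,
    segment_symm ℝ (L.tip u)]
  refine segment_union_segment ?_
  rw [tip, tip, arm_apply, arm_apply, hu.2.1, h1, h2, turn_odd, turn_even, position,
    ← image_segment]
  refine Set.mem_image_of_mem _ ?_
  -- The two ends are `l • d` and `-l' • d`, so the weights `l'` and `l` give the origin.
  refine ⟨L.spineLength u / (L.spineLength v + L.spineLength u),
    L.spineLength v / (L.spineLength v + L.spineLength u), by positivity, by positivity, ?_, ?_⟩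
  · field_simp
    ring
  · ext <;> simp <;> field_simp <;> ring

theorem segment_tip_farEnd_of_not {v : V} (hv : v ≠ L.root)
    (h : ¬ ∃ u, L.IsPartner u v) : segment ℝ (L.tip v) (L.farEnd v) = L.spine v := by
  rw [L.farEnd_of_not h, L.spine_eq hv]

theorem spine_subset_iUnion_segment {v : V} (hv : v ≠ L.root) :
    L.spine v ⊆ ⋃ w ∈ {w | L.IsSegmentStart w}, segment ℝ (L.tip w) (L.farEnd w) := by
  have start : ∀ v, L.IsSegmentStart v → L.spine v ⊆
      ⋃ w ∈ {w | L.IsSegmentStart w}, segment ℝ (L.tip w) (L.farEnd w) := by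
    intro v hv
    refine Set.Subset.trans ?_ (Set.subset_biUnion_of_mem
      (u := fun w => segment ℝ (L.tip w) (L.farEnd w)) (s := {w | L.IsSegmentStart w}) hv)
    by_cases hex : ∃ u, L.IsPartner u v
    · obtain ⟨u, hu⟩ := hex
      simp only [L.segment_tip_farEnd_of_isPartner hv hu]
      exact Set.subset_union_left
    · simp only [L.segment_tip_farEnd_of_not hv.1 hex]
      exact subset_rfl
  induction h : L.depth v generalizing v with
  | zero => exact absurd (L.eq_root_of_depth h) hv
  | succ n ih =>
    by_cases hp : L.par v = L.root
    · exact start v ⟨hv, Or.inl hp⟩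
    rcases eq_zero_or_odd_or_even (L.idx v) with hi | ⟨m, hi⟩ | ⟨m, hi⟩
    · have hd := L.depth_eq v hv
      refine Set.Subset.trans ?_ (ih hp (by omega))
      rw [L.spine_eq_union hp ⟨hv, rfl, hi⟩]
      exact Set.subset_union_right
    · exact start v ⟨hv, Or.inr ⟨m, hi⟩⟩
    · obtain ⟨u, hu, hpar, hi'⟩ := L.idx_pred v hv (2 * m + 1) hi
      have hus : L.IsSegmentStart u := ⟨hu, Or.inr ⟨m, hi'⟩⟩
      refine Set.Subset.trans ?_ (Set.subset_biUnion_of_mem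
        (u := fun w => segment ℝ (L.tip w) (L.farEnd w)) (s := {w | L.IsSegmentStart w}) hus)
      simp only [L.segment_tip_farEnd_of_isPartner hus (u := v) ⟨hv, hpar.symm, by omega⟩]
      exact Set.subset_union_right

theorem iUnion_segment_eq :
    ⋃ w ∈ {w | L.IsSegmentStart w}, segment ℝ (L.tip w) (L.farEnd w) =
      ⋃ w ∈ {w | w ≠ L.root}, L.edge w := by
  apply Set.Subset.antisymm
  · refine Set.iUnion₂_subset fun v (hv : L.IsSegmentStart v) => ?_
    by_cases hex : ∃ u, L.IsPartner u v
    · obtain ⟨u, hu⟩ := hex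
      rw [L.segment_tip_farEnd_of_isPartner hv hu]
      exact Set.union_subset (L.spine_subset_iUnion_edge hv.1) (L.spine_subset_iUnion_edge hu.1)
    · rw [L.segment_tip_farEnd_of_not hv.1 hex]
      exact L.spine_subset_iUnion_edge hv.1
  · exact Set.iUnion₂_subset fun v hv =>
      (L.edge_subset_spine hv).trans (L.spine_subset_iUnion_segment hv)

variable {L}

theorem isDrawnWithSegments_drawing {G : SimpleGraph V}
    (hG : ∀ u v, G.Adj u v ↔ (u ≠ L.root ∧ L.par u = v) ∨ (v ≠ L.root ∧ L.par v = u))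
    [Fintype {v // L.IsSegmentStart v}] :
    (drawing hG).IsDrawnWithSegments (Fintype.card {v // L.IsSegmentStart v}) := by
  let e := (Fintype.equivFin {v // L.IsSegmentStart v}).symm
  refine ⟨fun i => L.tip (e i), fun i => L.farEnd (e i), fun i => L.tip_ne_farEnd (e i).2, ?_⟩
  rw [e.surjective.iUnion_comp fun v : {v // L.IsSegmentStart v} =>
    segment ℝ (L.tip v) (L.farEnd v)]
  have h := L.iUnion_segment_eq
  rw [Set.biUnion_eq_iUnion] at h
  refine h.trans ?_
  ext x
  simp only [Set.mem_iUnion, Set.mem_ofPred_eq, exists_prop, StraightLineDrawing.edgePoints]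
  constructor
  · rintro ⟨w, hw, hx⟩
    exact ⟨L.par w, w, (hG _ _).2 (Or.inr ⟨hw, rfl⟩), hx⟩
  · rintro ⟨u, v, huv, hx⟩
    rcases (hG u v).1 huv with ⟨hu, rfl⟩ | ⟨hv, rfl⟩
    · exact ⟨u, hu, by rwa [edge, segment_symm]⟩
    · exact ⟨v, hv, hx⟩

end SpineLayout

/-! ### The number of segments -/

namespace SpineLayout

variable {V : Type*} (L : SpineLayout V) [Fintype V]

open Classical in
/-- The children of a vertex. -/
noncomputable def children (v : V) : Finset V := {u | u ≠ L.root ∧ L.par u = v}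

theorem mem_children {u v : V} : u ∈ L.children v ↔ u ≠ L.root ∧ L.par u = v := by
  simp [children]

/-- The children of a vertex carry the numbers below their number. -/
theorem image_idx_children (v : V) :
    (L.children v).image L.idx = Finset.range (L.children v).card := by
  have hinj : Set.InjOn L.idx (L.children v) := by
    intro a ha b hb h
    have ha := L.mem_children.1 ha
    have hb := L.mem_children.1 hb
    exact L.idx_inj a b ha.1 hb.1 (ha.2.trans hb.2.symm) h
  have hcard := Finset.card_image_of_injOn hinj
  -- The numbers in use are closed under predecessors.
  have hdown : ∀ j i, i ≤ j → j ∈ (L.children v).image L.idx → i ∈ (L.children v).image L.idx := by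
    intro j
    induction j with
    | zero =>
      intro i hi hj
      rwa [Nat.le_zero.1 hi]
    | succ j ih =>
      intro i hi hj
      rcases Nat.le_succ_iff.1 hi with hi | rfl
      · obtain ⟨u, hu, hu'⟩ := Finset.mem_image.1 hj
        have hu := L.mem_children.1 hu
        obtain ⟨w, hw, hp, hi'⟩ := L.idx_pred u hu.1 j hu'
        exact ih i hi (Finset.mem_image.2 ⟨w, L.mem_children.2 ⟨hw, hp.trans hu.2⟩, hi'⟩)
      · exact hj
  refine Finset.eq_of_subset_of_card_le (fun j hj => ?_) (by simp [hcard])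
  have hsub : Finset.range (j + 1) ⊆ (L.children v).image L.idx := fun i hi =>
    hdown j i (Nat.lt_succ_iff.1 (Finset.mem_range.1 hi)) hj
  have := Finset.card_le_card hsub
  rw [Finset.card_range, hcard] at this
  exact Finset.mem_range.2 this

theorem card_filter_odd_range (m : ℕ) : ((Finset.range m).filter Odd).card = m / 2 := by
  induction m with
  | zero => rfl
  | succ m ih =>
    rw [Finset.range_add_one, Finset.filter_insert]
    split_ifs with h
    · rw [Finset.card_insert_of_notMem (by simp), ih]
      obtain ⟨k, rfl⟩ := h
      omega
    · rw [ih]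
      obtain ⟨k, rfl⟩ := Nat.not_odd_iff_even.1 h
      omega

theorem card_filter_odd_idx_children (v : V) :
    ((L.children v).filter fun u => Odd (L.idx u)).card = (L.children v).card / 2 := by
  rw [← card_filter_odd_range, ← L.image_idx_children, Finset.filter_image,
    Finset.card_image_of_injOn]
  intro a ha b hb h
  have ha := L.mem_children.1 (Finset.mem_filter.1 ha).1
  have hb := L.mem_children.1 (Finset.mem_filter.1 hb).1
  exact L.idx_inj a b ha.1 hb.1 (ha.2.trans hb.2.symm) h

theorem sum_card_children : ∑ v, (L.children v).card + 1 = Fintype.card V := by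
  classical
  have h := Finset.card_eq_sum_card_fiberwise (f := L.par) (s := Finset.univ.erase L.root)
    (t := Finset.univ) (by simp)
  rw [Finset.card_erase_of_mem (Finset.mem_univ _), Finset.card_univ] at h
  have hpos : 0 < Fintype.card V := Fintype.card_pos_iff.2 ⟨L.root⟩
  have e : ∀ v, (Finset.univ.erase L.root).filter (fun u => L.par u = v) = L.children v := by
    intro v
    ext u
    simp [mem_children]
  simp only [e] at h
  omega

theorem card_isSegmentStart [Fintype {v // L.IsSegmentStart v}] :
    Fintype.card {v // L.IsSegmentStart v} =
      (L.children L.root).card + ∑ v, (L.children v).card / 2 := by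
  classical
  rw [Fintype.card_subtype]
  have hsplit : (Finset.univ.filter L.IsSegmentStart) = L.children L.root ∪
      Finset.univ.filter (fun v => v ≠ L.root ∧ Odd (L.idx v)) := by
    ext v
    simp only [Finset.mem_filter, Finset.mem_univ, true_and, Finset.mem_union, mem_children,
      IsSegmentStart]
    tauto
  have hdisj : Disjoint (L.children L.root)
      (Finset.univ.filter (fun v => v ≠ L.root ∧ Odd (L.idx v))) := by
    rw [Finset.disjoint_left]
    intro v hv hv'
    have hv := L.mem_children.1 hv
    have hv' := (Finset.mem_filter.1 hv').2.2
    rw [L.idx_root_child v hv.1 hv.2] at hv'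
    exact absurd hv' (by decide)
  rw [hsplit, Finset.card_union_of_disjoint hdisj, Finset.card_eq_sum_card_fiberwise (f := L.par)
    (s := Finset.univ.filter (fun v => v ≠ L.root ∧ Odd (L.idx v))) (t := Finset.univ) (by simp)]
  congr 1
  refine Finset.sum_congr rfl fun v _ => ?_
  rw [← L.card_filter_odd_idx_children]
  congr 1
  ext u
  simp only [Finset.mem_filter, Finset.mem_univ, true_and, mem_children]
  tauto

variable {L}

theorem degree_eq {G : SimpleGraph V} [DecidableRel G.Adj]
    (hG : ∀ u v, G.Adj u v ↔ (u ≠ L.root ∧ L.par u = v) ∨ (v ≠ L.root ∧ L.par v = u)) (v : V) :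
    (v = L.root → G.degree v = (L.children v).card) ∧
      (v ≠ L.root → G.degree v = (L.children v).card + 1) := by
  classical
  constructor
  · intro hv
    rw [← G.card_neighborFinset_eq_degree]
    congr 1
    ext u
    simp [mem_children, hG, hv]
  · intro hv
    have hnot : L.par v ∉ L.children v := by
      intro h
      have h := L.mem_children.1 h
      have h1 := L.depth_eq v hv
      have h2 := L.depth_eq _ h.1
      rw [h.2] at h2
      omega
    rw [← G.card_neighborFinset_eq_degree, ← Finset.card_insert_of_notMem hnot]
    congr 1
    ext u
    simp only [SimpleGraph.mem_neighborFinset, hG, hv, ne_eq, not_false_eq_true, true_and,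
      Finset.mem_insert, mem_children, eq_comm]

/-- If the root is a leaf, then the segments of the drawing are half as many as the vertices of odd
degree: a vertex with `c` children starts `c / 2` segments, and the root starts one more. -/
theorem two_mul_card_isSegmentStart {G : SimpleGraph V} [DecidableRel G.Adj]
    (hG : ∀ u v, G.Adj u v ↔ (u ≠ L.root ∧ L.par u = v) ∨ (v ≠ L.root ∧ L.par v = u))
    (hroot : G.degree L.root = 1) [Fintype {v // L.IsSegmentStart v}] :
    2 * Fintype.card {v // L.IsSegmentStart v} =
      (Finset.univ.filter fun v : V => Odd (G.degree v)).card := by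
  classical
  have h1 := L.sum_card_children
  have hr : (L.children L.root).card = 1 := ((degree_eq hG L.root).1 rfl).symm.trans hroot
  have hsum : ∑ v, ((if Odd (G.degree v) then 1 else 0) + (L.children v).card % 2) =
      ∑ v, (1 + if v = L.root then 1 else 0) := by
    refine Finset.sum_congr rfl fun v _ => ?_
    by_cases hv : v = L.root
    · subst hv
      simp [hroot, hr]
    · rw [(degree_eq hG v).2 hv, if_neg hv]
      rcases Nat.even_or_odd' (L.children v).card with ⟨m, hm | hm⟩
      · rw [if_pos ⟨m, by omega⟩, hm]
        omega
      · rw [if_neg (by rw [Nat.not_odd_iff_even]; exact ⟨m + 1, by omega⟩), hm]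
        omega
  have hsplit : ∑ v, (L.children v).card =
      ∑ v, (2 * ((L.children v).card / 2) + (L.children v).card % 2) :=
    Finset.sum_congr rfl fun v _ => (Nat.div_add_mod _ 2).symm
  simp only [Finset.sum_add_distrib, Finset.sum_const, Finset.card_univ, smul_eq_mul, mul_one,
    Finset.sum_ite_eq', Finset.mem_univ, if_true, ← Finset.mul_sum] at hsum hsplit
  rw [L.card_isSegmentStart, hr, Finset.card_filter]
  omega

end SpineLayout

/-! ### The lower bound on the number of segments -/

open Filter Topology in
theorem mem_of_frequently_add_mem {a b p d : ℝ × ℝ}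
    (h : ∃ᶠ t in 𝓝[>] (0 : ℝ), p + t • d ∈ segment ℝ a b) : p ∈ segment ℝ a b := by
  have hc : IsClosed (segment ℝ a b) := by
    rw [segment_eq_image_lineMap]
    exact (isCompact_Icc.image AffineMap.lineMap_continuous).isClosed
  have hlim : Tendsto (fun t : ℝ => p + t • d) (𝓝[>] 0) (𝓝 p) := by
    have : Continuous fun t : ℝ => p + t • d := by fun_prop
    simpa using (this.tendsto 0).mono_left nhdsWithin_le_nhds
  exact hc.closure_subset (mem_closure_of_frequently_of_tendsto h hlim)

open Filter Topology in
/-- If short steps from `p` in direction `d` stay in a closed segment and `p` is not an end of it,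
then short steps in the opposite direction stay in it, too. -/
theorem eventually_sub_mem_segment {a b p d : ℝ × ℝ} (ha : p ≠ a) (hb : p ≠ b)
    (h : ∃ᶠ t in 𝓝[>] (0 : ℝ), p + t • d ∈ segment ℝ a b) :
    ∀ᶠ t in 𝓝[>] (0 : ℝ), p + t • -d ∈ segment ℝ a b := by
  have hp : p ∈ segment ℝ a b := mem_of_frequently_add_mem h
  have hp' : p ∈ openSegment ℝ a b := mem_openSegment_of_ne_left_right ha.symm hb.symm hp
  rw [openSegment_eq_image'] at hp'
  obtain ⟨s, ⟨hs0, hs1⟩, rfl⟩ := hp'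
  obtain ⟨t, ht, ht0⟩ := (h.and_eventually self_mem_nhdsWithin).exists
  have ht0 : 0 < t := ht0
  rw [segment_eq_image'] at ht
  obtain ⟨s', -, hs'⟩ := ht
  simp only at hs'
  have hd : d = ((s' - s) / t) • (b - a) := by
    have h1 : t • d = (s' - s) • (b - a) := by
      rw [sub_smul]
      have := hs'
      rw [add_assoc, add_right_inj] at this
      rw [this]
      abel
    rw [div_eq_inv_mul, mul_smul, ← h1, smul_smul, inv_mul_cancel₀ ht0.ne', one_smul]
  have hlim : Tendsto (fun τ : ℝ => s - τ * ((s' - s) / t)) (𝓝[>] 0) (𝓝 s) := by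
    have : Continuous fun τ : ℝ => s - τ * ((s' - s) / t) := by fun_prop
    simpa using (this.tendsto 0).mono_left nhdsWithin_le_nhds
  filter_upwards [hlim.eventually (Icc_mem_nhds hs0 hs1)] with τ hτ
  rw [segment_eq_image']
  refine ⟨_, hτ, ?_⟩
  simp only
  rw [sub_smul, mul_smul, ← hd, smul_neg]
  abel

namespace StraightLineDrawing

open Filter Topology

variable {V : Type*} {G : SimpleGraph V} (D : StraightLineDrawing G)

/-- Different edges at a vertex have different directions. -/
theorem eq_of_sub_eq_smul {v u w : V} (hu : G.Adj v u) (hw : G.Adj v w) {c : ℝ} (hc : 0 < c)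
    (h : D.pos u - D.pos v = c • (D.pos w - D.pos v)) : u = w := by
  rcases le_total c 1 with hc1 | hc1
  · refine (D.vertex_not_on_edge v w u hw ?_).resolve_left hu.ne'
    rw [segment_eq_image']
    exact ⟨c, ⟨hc.le, hc1⟩, by simp only; rw [← h]; abel⟩
  · refine ((D.vertex_not_on_edge v u w hu ?_).resolve_left hw.ne').symm
    rw [segment_eq_image']
    refine ⟨c⁻¹, ⟨by positivity, inv_le_one_of_one_le₀ hc1⟩, ?_⟩
    simp only
    rw [h, smul_smul, inv_mul_cancel₀ hc.ne', one_smul]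
    abel

/-- At a vertex that is no end of a segment, every edge has an opposite edge. -/
theorem exists_opposite [Finite V] {k : ℕ} {a b : Fin k → ℝ × ℝ}
    (hab : ⋃ i, segment ℝ (a i) (b i) = D.edgePoints) {v u : V}
    (hv : ∀ i, D.pos v ≠ a i ∧ D.pos v ≠ b i) (hu : G.Adj v u) :
    ∃ w, G.Adj v w ∧ ∃ c : ℝ, 0 < c ∧ D.pos w - D.pos v = -(c • (D.pos u - D.pos v)) := by
  set p := D.pos v with hp
  set d := D.pos u - p with hd
  have hd0 : d ≠ 0 := sub_ne_zero.2 fun h => hu.ne' (D.pos_injective h)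
  have h1 : ∀ᶠ t in 𝓝[>] (0 : ℝ), ∃ i, p + t • d ∈ segment ℝ (a i) (b i) := by
    filter_upwards [Ioc_mem_nhdsGT (zero_lt_one (α := ℝ))] with t ht
    have : p + t • d ∈ D.edgePoints :=
      ⟨v, u, hu, by rw [segment_eq_image']; exact ⟨t, ⟨ht.1.le, ht.2⟩, rfl⟩⟩
    rw [← hab] at this
    exact Set.mem_iUnion.1 this
  obtain ⟨i, hi⟩ := frequently_exists.1 h1.frequently
  have h2 : ∀ᶠ t in 𝓝[>] (0 : ℝ),
      ∃ e : V × V, G.Adj e.1 e.2 ∧ p + t • -d ∈ segment ℝ (D.pos e.1) (D.pos e.2) := by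
    filter_upwards [eventually_sub_mem_segment (hv i).1 (hv i).2 hi] with t ht
    have : p + t • -d ∈ D.edgePoints := hab ▸ Set.mem_iUnion.2 ⟨i, ht⟩
    obtain ⟨x, y, hxy, h⟩ := this
    exact ⟨(x, y), hxy, h⟩
  obtain ⟨⟨x, y⟩, hxy⟩ := frequently_exists.1 h2.frequently
  have hadj : G.Adj x y := hxy.exists.choose_spec.1
  have hmem : ∃ᶠ t in 𝓝[>] (0 : ℝ), p + t • -d ∈ segment ℝ (D.pos x) (D.pos y) :=
    hxy.mono fun t ht => ht.2
  have hpm := mem_of_frequently_add_mem hmem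
  obtain ⟨w, hw, hseg⟩ : ∃ w, G.Adj v w ∧
      segment ℝ (D.pos x) (D.pos y) = segment ℝ p (D.pos w) := by
    rcases D.vertex_not_on_edge x y v hadj hpm with rfl | rfl
    · exact ⟨y, hadj, rfl⟩
    · exact ⟨x, hadj.symm, segment_symm _ _ _⟩
  obtain ⟨t, ht, ht0⟩ := (hmem.and_eventually self_mem_nhdsWithin).exists
  have ht0 : 0 < t := ht0
  rw [hseg, segment_eq_image'] at ht
  obtain ⟨s, ⟨hs0, -⟩, hs⟩ := ht
  simp only [add_right_inj] at hs
  have hs0 : 0 < s := by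
    refine hs0.lt_of_ne ?_
    rintro rfl
    rw [zero_smul] at hs
    exact hd0 (neg_eq_zero.1 ((smul_eq_zero.1 hs.symm).resolve_left ht0.ne'))
  refine ⟨w, hw, t / s, by positivity, ?_⟩
  rw [div_eq_inv_mul, mul_smul, ← smul_neg, ← smul_neg, ← hs, smul_smul, inv_mul_cancel₀ hs0.ne',
    one_smul]

theorem even_degree [Fintype V] [DecidableRel G.Adj] {k : ℕ} {a b : Fin k → ℝ × ℝ}
    (hab : ⋃ i, segment ℝ (a i) (b i) = D.edgePoints) {v : V}
    (hv : ∀ i, D.pos v ≠ a i ∧ D.pos v ≠ b i) : Even (G.degree v) := by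
  classical
  have hex : ∀ u ∈ G.neighborFinset v, ∃ w, G.Adj v w ∧
      ∃ c : ℝ, 0 < c ∧ D.pos w - D.pos v = -(c • (D.pos u - D.pos v)) := fun u hu =>
    D.exists_opposite hab hv ((G.mem_neighborFinset v u).1 hu)
  choose f hf c hc hfc using hex
  have h2 : ∑ _u ∈ G.neighborFinset v, (1 : ZMod 2) = 0 := by
    refine Finset.sum_involution f (fun u hu => by decide) ?_
      (fun u hu => (G.mem_neighborFinset v _).2 (hf u hu)) ?_
    · intro u hu _ h
      have h0 := hfc u hu
      rw [h, eq_neg_iff_add_eq_zero, ← one_smul ℝ (D.pos u - D.pos v), smul_smul, mul_one,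
        ← add_smul, smul_eq_zero, sub_eq_zero] at h0
      have hcu := hc u hu
      rcases h0 with h0 | h0
      · linarith
      · exact ((G.mem_neighborFinset v u).1 hu).ne' (D.pos_injective h0)
    · intro u hu
      have hm := (G.mem_neighborFinset v _).2 (hf u hu)
      refine D.eq_of_sub_eq_smul (hf _ hm) ((G.mem_neighborFinset v u).1 hu)
        (mul_pos (hc _ hm) (hc u hu)) ?_
      rw [hfc _ hm, hfc u hu, smul_neg, neg_neg, smul_smul]
  rw [Finset.sum_const, nsmul_one, G.card_neighborFinset_eq_degree] at h2
  exact (ZMod.natCast_eq_zero_iff_even).1 h2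

/-- Every vertex of odd degree is an end of a segment, and a segment has two ends. -/
theorem card_odd_degree_le [Fintype V] [DecidableRel G.Adj] {k : ℕ}
    (h : D.IsDrawnWithSegments k) :
    (Finset.univ.filter fun v : V => Odd (G.degree v)).card ≤ 2 * k := by
  classical
  obtain ⟨a, b, -, hab⟩ := h
  have hsub : (Finset.univ.filter fun v : V => Odd (G.degree v)).image D.pos ⊆
      Finset.univ.image a ∪ Finset.univ.image b := by
    intro x hx
    obtain ⟨v, hv, rfl⟩ := Finset.mem_image.1 hx
    have hv := (Finset.mem_filter.1 hv).2
    by_contra hn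
    simp only [Finset.mem_union, Finset.mem_image, Finset.mem_univ, true_and, not_or,
      not_exists] at hn
    exact Nat.not_even_iff_odd.2 hv
      (D.even_degree hab fun i => ⟨fun e => hn.1 i e.symm, fun e => hn.2 i e.symm⟩)
  calc _ = ((Finset.univ.filter fun v : V => Odd (G.degree v)).image D.pos).card :=
        (Finset.card_image_of_injective _ D.pos_injective).symm
    _ ≤ _ := Finset.card_le_card hsub
    _ ≤ (Finset.univ.image a).card + (Finset.univ.image b).card := Finset.card_union_le _ _
    _ ≤ k + k := by
        gcongr <;> exact Finset.card_image_le.trans (by simp)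
    _ = 2 * k := (two_mul k).symm

end StraightLineDrawing

/-! ### Layouts of trees -/

/-- Numbers for the elements of a finite set, starting with one of greatest size. -/
theorem exists_numbering {α : Type*} (A : Finset α) (s : α → ℕ) :
    ∃ f : α → ℕ, (∀ a ∈ A, ∀ b ∈ A, f a = f b → a = b) ∧ (∀ a ∈ A, f a < A.card) ∧
      (∀ i < A.card, ∃ a ∈ A, f a = i) ∧ ∀ a ∈ A, f a = 0 → ∀ b ∈ A, s b ≤ s a := by
  classical
  suffices h : ∃ f : α → ℕ, (∀ a ∈ A, ∀ b ∈ A, f a = f b → a = b) ∧ (∀ a ∈ A, f a < A.card) ∧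
      ∀ a ∈ A, f a = 0 → ∀ b ∈ A, s b ≤ s a by
    obtain ⟨f, hinj, hlt, hmax⟩ := h
    have himg : A.image f = Finset.range A.card := by
      refine Finset.eq_of_subset_of_card_le (fun i hi => ?_) ?_
      · obtain ⟨a, ha, rfl⟩ := Finset.mem_image.1 hi
        exact Finset.mem_range.2 (hlt a ha)
      · rw [Finset.card_image_of_injOn fun a ha b hb => hinj a ha b hb, Finset.card_range]
    exact ⟨f, hinj, hlt, fun i hi => Finset.mem_image.1 (himg ▸ Finset.mem_range.2 hi), hmax⟩
  rcases A.eq_empty_or_nonempty with rfl | hA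
  · exact ⟨fun _ => 0, by simp⟩
  obtain ⟨m, hm, hmax⟩ := A.exists_max_image s hA
  let e := (A.erase m).equivFin
  have hcard : (A.erase m).card + 1 = A.card := Finset.card_erase_add_one hm
  refine ⟨fun a => if h : a ∈ A.erase m then e ⟨a, h⟩ + 1 else 0, ?_, ?_, ?_⟩
  · intro a ha b hb h
    by_cases h1 : a = m <;> by_cases h2 : b = m
    · rw [h1, h2]
    · simp [h1, h2, hb] at h
    · simp [h1, h2, ha] at h
    · simp only [Finset.mem_erase, h1, h2, ha, hb, ne_eq, not_false_eq_true, and_self, dite_true,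
        Nat.add_right_cancel_iff, Fin.val_inj, e.injective.eq_iff, Subtype.mk.injEq] at h
      exact h
  · intro a ha
    by_cases h1 : a = m
    · simp only [Finset.mem_erase, h1, ne_eq, not_true_eq_false, false_and, dite_false]
      omega
    · simp only [Finset.mem_erase, h1, ha, ne_eq, not_false_eq_true, and_self, dite_true]
      have := (e ⟨a, Finset.mem_erase.2 ⟨h1, ha⟩⟩).2
      omega
  · intro a ha h b hb
    by_cases h1 : a = m
    · rw [h1]
      exact hmax b hb
    · simp [h1, ha] at h

theorem exists_adj_dist_succ {V : Type*} {G : SimpleGraph V} (hG : G.Connected) {r v : V}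
    (hv : v ≠ r) : ∃ u, G.Adj v u ∧ G.dist v r = G.dist u r + 1 := by
  obtain ⟨p, hp⟩ := hG.exists_walk_length_eq_dist v r
  cases p with
  | nil => exact absurd rfl hv
  | cons h q =>
    rename_i u
    refine ⟨u, h, le_antisymm ?_ ?_⟩
    · have h1 := hG.dist_triangle (u := v) (v := u) (w := r)
      rw [SimpleGraph.dist_eq_one_iff_adj.2 h] at h1
      omega
    · have h1 := SimpleGraph.dist_le q
      rw [← hp, SimpleGraph.Walk.length_cons]
      omega

/-- A tree, rooted at `r`. The edges to the parents are different and as many as there are edges,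
so there are no others. -/
theorem exists_parent {V : Type*} [Fintype V] {G : SimpleGraph V} (hG : G.IsTree) (r : V) :
    ∃ par : V → V, par r = r ∧ (∀ v, v ≠ r → G.dist v r = G.dist (par v) r + 1) ∧
      ∀ u v, G.Adj u v ↔ (u ≠ r ∧ par u = v) ∨ (v ≠ r ∧ par v = u) := by
  classical
  have hex : ∀ v, ∃ u, (v = r → u = r) ∧ (v ≠ r → G.Adj v u ∧ G.dist v r = G.dist u r + 1) := by
    intro v
    by_cases hv : v = r
    · exact ⟨r, fun _ => rfl, fun h => absurd hv h⟩
    · obtain ⟨u, hu⟩ := exists_adj_dist_succ hG.connected hv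
      exact ⟨u, fun h => absurd h hv, fun _ => hu⟩
  choose par hr hpar using hex
  have hinj : Set.InjOn (fun v => s(v, par v)) (Finset.univ.erase r : Finset V) := by
    intro v hv w hw h
    have hv := (hpar v (Finset.ne_of_mem_erase hv)).2
    have hw := (hpar w (Finset.ne_of_mem_erase hw)).2
    rcases Sym2.eq_iff.1 h with ⟨h, -⟩ | ⟨h1, h2⟩
    · exact h
    · rw [h2] at hv
      rw [← h1] at hw
      omega
  have himg : (Finset.univ.erase r).image (fun v => s(v, par v)) = G.edgeFinset := by
    refine Finset.eq_of_subset_of_card_le ?_ ?_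
    · intro e he
      obtain ⟨v, hv, rfl⟩ := Finset.mem_image.1 he
      exact SimpleGraph.mem_edgeFinset.2 (hpar v (Finset.ne_of_mem_erase hv)).1
    · rw [Finset.card_image_of_injOn hinj, Finset.card_erase_of_mem (Finset.mem_univ _),
        Finset.card_univ, ← hG.card_edgeFinset]
      omega
  refine ⟨par, hr r rfl, fun v hv => (hpar v hv).2, fun u v => ⟨fun h => ?_, ?_⟩⟩
  · have he : s(u, v) ∈ G.edgeFinset := SimpleGraph.mem_edgeFinset.2 h
    rw [← himg] at he
    obtain ⟨w, hw, h⟩ := Finset.mem_image.1 he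
    have hw := Finset.ne_of_mem_erase hw
    rcases Sym2.eq_iff.1 h with ⟨rfl, rfl⟩ | ⟨rfl, rfl⟩
    · exact Or.inl ⟨hw, rfl⟩
    · exact Or.inr ⟨hw, rfl⟩
  · rintro (⟨hu, rfl⟩ | ⟨hv, rfl⟩)
    · exact (hpar u hu).1
    · exact (hpar v hv).1.symm

/-- The numbers of vertices of the subtrees of a rooted tree. -/
theorem exists_subtree_card {V : Type*} [Fintype V] {r : V} {par : V → V} {depth : V → ℕ}
    (hr : par r = r) (h0 : depth r = 0) (hd : ∀ v, v ≠ r → depth v = depth (par v) + 1) :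
    ∃ s : V → ℕ, (∀ v, 0 < s v ∧ s v ≤ Fintype.card V) ∧
      (∀ v, v ≠ r → s v < s (par v)) ∧
      ∀ u v, u ≠ r → v ≠ r → par u = par v → u ≠ v → s u + s v < s (par v) := by
  classical
  let desc : V → Finset V := fun v => Finset.univ.filter fun w => ∃ k, par^[k] w = v
  have mem_desc : ∀ v w, w ∈ desc v ↔ ∃ k, par^[k] w = v := fun v w => by simp [desc]
  have hself : ∀ v, v ∈ desc v := fun v => (mem_desc v v).2 ⟨0, rfl⟩
  have hdepth : ∀ k w, depth (par^[k] w) = depth w - k := by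
    intro k
    induction k with
    | zero => intro w; rfl
    | succ k ih =>
      intro w
      rw [Function.iterate_succ_apply', ← Nat.sub_sub, ← ih]
      by_cases h : par^[k] w = r
      · rw [h, hr, h0]
      · have := hd _ h
        omega
  have hsub : ∀ v, desc v ⊆ desc (par v) := by
    intro v w hw
    obtain ⟨k, rfl⟩ := (mem_desc v w).1 hw
    exact (mem_desc _ _).2 ⟨k + 1, Function.iterate_succ_apply' _ _ _⟩
  have hnot : ∀ v, v ≠ r → par v ∉ desc v := by
    intro v hv h
    obtain ⟨k, hk⟩ := (mem_desc _ _).1 h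
    have h1 := hdepth k (par v)
    have h2 := hd v hv
    rw [hk] at h1
    omega
  refine ⟨fun v => (desc v).card, fun v => ⟨Finset.card_pos.2 ⟨v, hself v⟩,
    Finset.card_le_univ _⟩, fun v hv => Finset.card_lt_card ?_, fun u v hu hv hp huv => ?_⟩
  · exact ⟨hsub v, fun h => hnot v hv (h (hself _))⟩
  · have hdisj : Disjoint (desc u) (desc v) := by
      rw [Finset.disjoint_left]
      intro w hwu hwv
      obtain ⟨k, hk⟩ := (mem_desc _ _).1 hwu
      obtain ⟨l, hl⟩ := (mem_desc _ _).1 hwv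
      have h1 := hdepth k w
      have h2 := hdepth l w
      have h3 := hd u hu
      have h4 := hd v hv
      rw [hk] at h1
      rw [hl] at h2
      rw [hp] at h3
      have : k = l := by omega
      subst this
      exact huv (hk.symm.trans hl)
    rw [← Finset.card_union_of_disjoint hdisj]
    refine Finset.card_lt_card ⟨Finset.union_subset (hp ▸ hsub u) (hsub v), fun h => ?_⟩
    rcases Finset.mem_union.1 (h (hself (par v))) with h | h
    · exact hnot u hu (hp ▸ h)
    · exact hnot v hv h

/-- With `0` as the number of a child of greatest size, the numbers `s v * (3 * n) ^ log₂ (s v)`,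
where `s v` is the size of the subtree at `v`, can serve as extents: each other child has at most
half the size of its parent, which pays for a factor `3 * n`. -/
theorem exists_spineLayout {V : Type*} [Fintype V] {G : SimpleGraph V} [DecidableRel G.Adj]
    (hG : G.IsTree) {r : V} (hr : G.degree r = 1) :
    ∃ L : SpineLayout V, L.root = r ∧
      L.shift = Fintype.card V * (3 * Fintype.card V) ^ Nat.log 2 (Fintype.card V) ∧
      ∀ u v, G.Adj u v ↔ (u ≠ L.root ∧ L.par u = v) ∨ (v ≠ L.root ∧ L.par v = u) := by
  classical
  obtain ⟨par, hpr, hd, hadj⟩ := exists_parent hG r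
  obtain ⟨s, hs, hlt, hadd⟩ := exists_subtree_card (depth := fun v => G.dist v r) hpr
    SimpleGraph.dist_self hd
  let ch : V → Finset V := fun v => Finset.univ.filter fun u => u ≠ r ∧ par u = v
  have mem_ch : ∀ u v, u ∈ ch v ↔ u ≠ r ∧ par u = v := fun u v => by simp [ch]
  choose f hinj hcard hsurj hmax using fun v => exists_numbering (ch v) s
  let hs' : V → ℕ := fun v => (ch v).sup s
  have hn : 0 < Fintype.card V := Fintype.card_pos_iff.2 ⟨r⟩
  have hmem : ∀ v, v ≠ r → v ∈ ch (par v) := fun v hv => (mem_ch v _).2 ⟨hv, rfl⟩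
  have hchlt : ∀ v, (ch v).card < Fintype.card V := by
    intro v
    refine Finset.card_lt_card ((Finset.ssubset_univ_iff).2 fun h => ?_)
    exact ((mem_ch r v).1 (h ▸ Finset.mem_univ r)).1 rfl
  have hs'lt : ∀ v, hs' v < s v := by
    intro v
    refine (Finset.sup_lt_iff (hs v).1).2 fun u hu => ?_
    obtain ⟨h1, rfl⟩ := (mem_ch u v).1 hu
    exact hlt u h1
  have hle : ∀ v, v ≠ r → s v ≤ hs' (par v) := fun v hv => Finset.le_sup (hmem v hv)
  have heavy : ∀ v, v ≠ r → f (par v) v = 0 → hs' (par v) = s v := fun v hv h =>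
    le_antisymm (Finset.sup_le (hmax _ v (hmem v hv) h)) (hle v hv)
  -- The sizes of a child of greatest size and of any other child add up.
  have light : ∀ v, v ≠ r → f (par v) v ≠ 0 → s v + hs' (par v) < s (par v) := by
    intro v hv h
    obtain ⟨m, hm, hmm⟩ := (ch (par v)).exists_mem_eq_sup ⟨v, hmem v hv⟩ s
    have hm' := (mem_ch _ _).1 hm
    by_cases hvm : v = m
    · -- Then the child with number `0` has the same size as `v`.
      obtain ⟨z, hz, hz0⟩ := hsurj (par v) 0 (Finset.card_pos.2 ⟨v, hmem v hv⟩)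
      have hz' := (mem_ch _ _).1 hz
      have hzv : z ≠ v := by
        rintro rfl
        exact h hz0
      have h1 := hadd v z hv hz'.1 hz'.2.symm hzv.symm
      have h2 := heavy z hz'.1 (by rw [hz'.2]; exact hz0)
      rw [hz'.2] at h1 h2
      omega
    · have h1 := hadd v m hv hm'.1 hm'.2.symm hvm
      rw [hm'.2] at h1
      have h2 : hs' (par v) = s m := hmm
      omega
  have log_light : ∀ v, v ≠ r → f (par v) v ≠ 0 → Nat.log 2 (s v) + 1 ≤ Nat.log 2 (s (par v)) := by
    intro v hv h
    have h1 := light v hv h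
    have h2 := hle v hv
    rw [← Nat.log_mul_base one_lt_two (hs v).1.ne']
    exact Nat.log_mono_right (by omega)
  set n := Fintype.card V with hndef
  have hP : 0 < 3 * n := by omega
  refine ⟨{
    root := r
    par := par
    depth := fun v => G.dist v r
    depth_root := SimpleGraph.dist_self
    depth_eq := hd
    idx := fun v => f (par v) v
    idx_inj := ?_
    idx_pred := ?_
    idx_root_child := ?_
    flat := n
    idx_lt := fun v hv => (hcard _ v (hmem v hv)).trans (hchlt _)
    step := fun v => (s v - hs' v) * (3 * n) ^ Nat.log 2 (s v)
    reach := fun v => s v * (3 * n) ^ Nat.log 2 (s v)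
    step_pos := fun v _ => Nat.mul_pos (Nat.sub_pos_of_lt (hs'lt v)) (Nat.pow_pos hP)
    step_le_reach := fun v _ => Nat.mul_le_mul_right _ (Nat.sub_le _ _)
    reach_spine := ?_
    le_step := ?_
    reach_turned := ?_
    shift := n * (3 * n) ^ Nat.log 2 n
    reach_le_shift := fun v _ => Nat.mul_le_mul (hs v).2
      (Nat.pow_le_pow_right hP (Nat.log_mono_right (hs v).2)) }, rfl, rfl, hadj⟩
  · intro u v hu hv hp h
    rw [hp] at h
    exact hinj (par v) u (hp ▸ hmem u hu) v (hmem v hv) h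
  · intro v hv i hi
    obtain ⟨z, hz, hz0⟩ := hsurj (par v) i (by have := hcard _ v (hmem v hv); omega)
    have hz' := (mem_ch _ _).1 hz
    exact ⟨z, hz'.1, hz'.2, by rw [hz'.2]; exact hz0⟩
  · intro v hv hp
    -- The root is a leaf, so it has a single child.
    have h1 : (ch r).card ≤ 1 := by
      rw [← hr, ← G.card_neighborFinset_eq_degree]
      refine Finset.card_le_card fun u hu => ?_
      have hu := (mem_ch _ _).1 hu
      exact (G.mem_neighborFinset r u).2 ((hadj r u).2 (Or.inr hu))
    have h2 := hcard _ v (hmem v hv)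
    rw [hp] at h2
    rw [hp]
    omega
  · intro v hv _ h
    have h1 := hs'lt (par v)
    rw [heavy v hv h] at h1 ⊢
    have h2 : (3 * n) ^ Nat.log 2 (s v) ≤ (3 * n) ^ Nat.log 2 (s (par v)) :=
      Nat.pow_le_pow_right hP (Nat.log_mono_right h1.le)
    calc _ ≤ (s (par v) - s v) * (3 * n) ^ Nat.log 2 (s (par v)) +
          s v * (3 * n) ^ Nat.log 2 (s (par v)) := by gcongr
      _ = _ := by rw [← add_mul, Nat.sub_add_cancel h1.le]
  · intro v hv _ h
    have h1 := light v hv h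
    calc 2 * n * (s v * (3 * n) ^ Nat.log 2 (s v))
        ≤ s v * (3 * n) ^ (Nat.log 2 (s v) + 1) := by
          rw [pow_succ]
          nlinarith [Nat.zero_le (s v * (3 * n) ^ Nat.log 2 (s v) * n)]
      _ ≤ _ := Nat.mul_le_mul (by omega) (Nat.pow_le_pow_right hP (log_light v hv h))
  · intro v hv _ h
    have h1 := hs'lt (par v)
    have h2 := hle v hv
    calc (s (par v) - hs' (par v)) * (3 * n) ^ Nat.log 2 (s (par v)) +
          n * (s v * (3 * n) ^ Nat.log 2 (s v))
        ≤ (s (par v) - hs' (par v)) * (3 * n) ^ Nat.log 2 (s (par v)) +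
          s v * (3 * n) ^ (Nat.log 2 (s v) + 1) := by
          rw [pow_succ]
          nlinarith [Nat.zero_le (s v * (3 * n) ^ Nat.log 2 (s v) * n)]
      _ ≤ (s (par v) - hs' (par v)) * (3 * n) ^ Nat.log 2 (s (par v)) +
          hs' (par v) * (3 * n) ^ Nat.log 2 (s (par v)) :=
          Nat.add_le_add_left
            (Nat.mul_le_mul h2 (Nat.pow_le_pow_right hP (log_light v hv h))) _
      _ = _ := by rw [← add_mul, Nat.sub_add_cancel h1.le]

theorem two_mul_shift_le_rpow {n : ℕ} (hn : 2 ≤ n) :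
    ((2 * (n * (3 * n) ^ Nat.log 2 n) : ℕ) : ℝ) ≤ (n : ℝ) ^ (5 * Real.logb 2 n) := by
  have h1 : 2 * (n * (3 * n) ^ Nat.log 2 n) ≤ n ^ (2 + 3 * Nat.log 2 n) := by
    have h3 : 3 * n ≤ n ^ 3 := by nlinarith [Nat.mul_le_mul hn hn]
    calc 2 * (n * (3 * n) ^ Nat.log 2 n) ≤ n * (n * (n ^ 3) ^ Nat.log 2 n) := by gcongr
      _ = n ^ (2 + 3 * Nat.log 2 n) := by rw [← pow_mul, pow_add]; ring
  have h2 : (Nat.log 2 n : ℝ) ≤ Real.logb 2 n := by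
    exact_mod_cast Real.natLog_le_logb n 2
  have h3 : (1 : ℝ) ≤ Nat.log 2 n := by
    exact_mod_cast Nat.log_pos one_lt_two hn
  have h4 : (1 : ℝ) ≤ n := by
    exact_mod_cast (show 1 ≤ n by omega)
  calc ((2 * (n * (3 * n) ^ Nat.log 2 n) : ℕ) : ℝ) ≤ ((n ^ (2 + 3 * Nat.log 2 n) : ℕ) : ℝ) :=
        Nat.cast_le.2 h1
    _ = (n : ℝ) ^ ((2 + 3 * Nat.log 2 n : ℕ) : ℝ) := by rw [Real.rpow_natCast, Nat.cast_pow]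
    _ ≤ _ := by
        refine Real.rpow_le_rpow_of_exponent_le h4 ?_
        push_cast
        linarith

theorem mainTheorem4 : ∃ C : ℝ, 0 < C ∧
    ∀ (V : Type*) [Fintype V] (G : SimpleGraph V) [DecidableRel G.Adj], G.IsTree →
      ∃ (D : StraightLineDrawing G) (W H k : ℕ),
        D.IsOnGrid W H ∧
        (W : ℝ) ≤ (Fintype.card V : ℝ) ^ (C * Real.logb 2 (Fintype.card V)) ∧
        (H : ℝ) ≤ (Fintype.card V : ℝ) ^ (C * Real.logb 2 (Fintype.card V)) ∧
        D.IsDrawnWithSegments k ∧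
        2 * k = (Finset.univ.filter fun v : V => Odd (G.degree v)).card ∧
        ∀ (D' : StraightLineDrawing G) (k' : ℕ), D'.IsDrawnWithSegments k' → k ≤ k' := by
  classical
  refine ⟨5, by norm_num, fun V _ G _ hG => ?_⟩
  -- The lower bound on the number of segments holds for every drawing.
  suffices h : ∃ (D : StraightLineDrawing G) (W k : ℕ), D.IsOnGrid W W ∧
      (W : ℝ) ≤ (Fintype.card V : ℝ) ^ (5 * Real.logb 2 (Fintype.card V)) ∧
      D.IsDrawnWithSegments k ∧
      2 * k = (Finset.univ.filter fun v : V => Odd (G.degree v)).card by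
    obtain ⟨D, W, k, h1, h2, h3, h4⟩ := h
    refine ⟨D, W, W, k, h1, h2, h2, h3, h4, fun D' k' h' => ?_⟩
    have := D'.card_odd_degree_le h'
    omega
  have := hG.connected.nonempty
  rcases subsingleton_or_nontrivial V with hV | hV
  · have hadj : ∀ u v, ¬ G.Adj u v := fun u v h => h.ne (Subsingleton.elim u v)
    refine ⟨⟨fun _ => 0, Function.injective_of_subsingleton _, fun u v _ h => absurd h (hadj u v),
      fun u v _ _ h => absurd h (hadj u v)⟩, 0, 0,
      fun _ => ⟨0, 0, le_rfl, le_rfl, by simp; rfl⟩, by simp; positivity, ⟨Fin.elim0, Fin.elim0,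
        fun i => i.elim0, ?_⟩, ?_⟩
    · ext x
      simp [StraightLineDrawing.edgePoints, hadj]
    · simp
  · obtain ⟨r, hr⟩ := hG.exists_vert_degree_one_of_nontrivial
    obtain ⟨L, rfl, hshift, hL⟩ := exists_spineLayout hG hr
    refine ⟨SpineLayout.drawing hL, 2 * L.shift, _, L.exists_nat_position, ?_,
      SpineLayout.isDrawnWithSegments_drawing hL, SpineLayout.two_mul_card_isSegmentStart hL hr⟩
    rw [hshift]
    exact two_mul_shift_le_rpow Fintype.one_lt_card
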